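/- All spaces are nonempty. A continuous map $f:E_1\to E_2$ of metric spaces is *almost open* if $f(U)$ has nonempty interior for every nonempty open $U\subset E_1$. A continuous surjection $h:Y\to X$ of compact metric spaces is *irreducible* if the only closed $A\subset Y$ with $h(A)=X$ is $A=Y$. A *suitable relation* $F:X_1\to X_2$ between compact metric spaces is a closed subset $F\subset X_1\times X_2$ such that the projection $F\to X_1$ is irreducible and the projection $F\to X_2$ is almost open. For suitable relations $F:X_1\to X_2$ and $G:X_2\to X_3$, the *suitable composition* $G\bullet F\subset X_1\times X_3$ is the projection to the first and third coordinates of the closure in $X_1\times X_2\times X_3$ of $$\{(x,y,z): (x,y)\in F,\ (y,z)\in G,\ \{z' : (y,z')\in G\}\text{ is a singleton}\}.$$ A suitable relation $F:X_1\to X_2$ is a *suitable relations isomorphism* if there is a suitable relation $G:X_2\to X_1$ with $G\bullet F=1_{X_1}$ and $F\bullet G=1_{X_2}$, where $1_X=\{(x,x):x\in X\}$. A map $h:Y\to X$ *maps* a map $g:Y\to Y$ to a relation $F\subset X\times X$ if $(h(y),h(g(y)))\in F$ for all $y\in Y$. **Theorem 4.10.** Let $X$ be a nonempty compact metric space without isolated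 points, let $F\subset X\times X$ be a suitable relation on $X$, and let $C$ be the Cantor set. Then there exist an almost open continuous map $g:C\to C$ and an irreducible map $h:C\to X$ which maps $g$ to $F$. Furthermore, if $F$ is a suitable relations isomorphism, then there exist a homeomorphism $g:C\to C$ and an irreducible map $h:C\to X$ which maps $g$ to $F$. -/

import Mathlib

open Set

/-- A map is almost open when the image of every nonempty open set has nonempty interior.
(Continuity is required separately where it is needed.) -/
def IsAlmostOpen {E₁ E₂ : Type*} [TopologicalSpace E₁] [TopologicalSpace E₂]
    (f : E₁ → E₂) : Prop :=
  ∀ U : Set E₁, IsOpen U → U.Nonempty → (interior (f '' U)).Nonempty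

/-- `A` is minimal for `f`: it is a minimal element of the class of closed subsets of the domain
which `f` maps onto the codomain. -/
def IsMinimalFor {X₁ X₂ : Type*} [TopologicalSpace X₁] (f : X₁ → X₂) (A : Set X₁) : Prop :=
  Minimal (fun B : Set X₁ => IsClosed B ∧ f '' B = univ) A

/-- An irreducible map: a continuous surjection whose whole domain is minimal for it. -/
structure IsIrreducibleMap {X₁ X₂ : Type*} [TopologicalSpace X₁] [TopologicalSpace X₂]
    (f : X₁ → X₂) : Prop where
  continuous : Continuous f
  surjective : Function.Surjective f
  minimal : IsMinimalFor f univ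

/-- A suitable relation `F : X₁ → X₂`: a closed subset of `X₁ × X₂` whose first projection
`F → X₁` is irreducible and whose second projection `F → X₂` (automatically continuous) is
almost open. -/
structure IsSuitable {X₁ X₂ : Type*} [TopologicalSpace X₁] [TopologicalSpace X₂]
    (F : SetRel X₁ X₂) : Prop where
  isClosed : IsClosed F
  irreducible_fst : IsIrreducibleMap (fun p : ↥F => p.1.1)
  almostOpen_snd : IsAlmostOpen (fun p : ↥F => p.1.2)

/-- The set of points `x` at which `F(x)` is a singleton. -/
def oneSet {X₁ X₂ : Type*} (F : SetRel X₁ X₂) : Set X₁ :=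
  {x | ∃! y, (x, y) ∈ F}

/-- The set `G ⊗ F` of all `(x, y, z)` with `(x, y) ∈ F` and `(y, z) ∈ G`. Its projection to the
first and third coordinates is the usual composition of relations. -/
def relTensor {X₁ X₂ X₃ : Type*} (G : SetRel X₂ X₃) (F : SetRel X₁ X₂) : Set (X₁ × X₂ × X₃) :=
  {p | (p.1, p.2.1) ∈ F ∧ (p.2.1, p.2.2) ∈ G}

/-- The suitable composition `G • F`: the projection to the first and third coordinates of the
closure of the set of those `(x, y, z) ∈ G ⊗ F` for which `G(y)` is a singleton. -/
def suitableComp {X₁ X₂ X₃ : Type*} [TopologicalSpace X₁] [TopologicalSpace X₂]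
    [TopologicalSpace X₃] (G : SetRel X₂ X₃) (F : SetRel X₁ X₂) : SetRel X₁ X₃ :=
  (fun p : X₁ × X₂ × X₃ => (p.1, p.2.2)) ''
    closure (relTensor G F ∩ {p : X₁ × X₂ × X₃ | p.2.1 ∈ oneSet G})

/-- An isomorphism in the category of suitable relations with suitable composition, whose
identity morphisms are the diagonals. -/
def IsSuitableIso {X₁ X₂ : Type*} [TopologicalSpace X₁] [TopologicalSpace X₂]
    (F : SetRel X₁ X₂) : Prop :=
  IsSuitable F ∧ ∃ G : SetRel X₂ X₁, IsSuitable G ∧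
    suitableComp G F = SetRel.id ∧ suitableComp F G = SetRel.id

/-- `h : Y → X` maps the relation `G` on `Y` to the relation `F` on `X` when
`(h × h)(G) ⊆ F`. -/
def MapsRel {Y X : Type*} (h : Y → X) (G : SetRel Y Y) (F : SetRel X X) : Prop :=
  Prod.map h h '' G ⊆ F

/-! Pick any selection `f` of `F`. A closed relation on a compact space is upper semicontinuous and
the first projection of `F` is irreducible, so `F` is single-valued on a residual set, where `f` is
continuous. Since the second projection is almost open, `f` pulls residual sets back to residual
sets. Hence the set `D` of points whose whole orbit stays in that set and avoids the frontiers of a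
countable separating family of open sets `b k` is `f`-invariant and, by Baire, dense.

On `D` the code `E x = (itinerary of f^n x in the b k, f^n x)_n` is continuous. Let `K` be the
closure of `E(D)`. The bits determine the points of `K`, so `K` is totally disconnected; `D` is
dense in the perfect space `X`, so `K` is perfect; by Brouwer `K` is a Cantor set. The shift on `K`
extends `f` and is the required `g`; coordinate zero is `h`, irreducible because it is injective
over `D`.

If `F` is an isomorphism, a selection of its inverse inverts `f` on a smaller dense `D`. Coding
orbits over `ℤ` then makes the shift a homeomorphism. -/

/-! ### Brouwer's characterization of the Cantor set. -/

section CantorSpaceCharacterization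

open TopologicalSpace Topology

/-- In a totally disconnected compact Hausdorff space without isolated points, every nonempty
clopen set is split by a clopen set into two nonempty parts, neither of which is cut by a
prescribed clopen set. -/
theorem IsClopen.exists_splitting {K : Type*} [TopologicalSpace K] [CompactSpace K] [T2Space K]
    [TotallyDisconnectedSpace K] (hK : ∀ x : K, ¬ IsOpen ({x} : Set K)) {A c : Set K}
    (hA : IsClopen A) (hne : A.Nonempty) (hc : IsClopen c) :
    ∃ T : Set K, IsClopen T ∧ (A ∩ T).Nonempty ∧ (A \ T).Nonempty ∧
      (A ∩ T ⊆ c ∨ A ∩ T ⊆ cᶜ) ∧ (A \ T ⊆ c ∨ A \ T ⊆ cᶜ) := by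
  by_cases h : (A ∩ c).Nonempty ∧ (A \ c).Nonempty
  · exact ⟨c, hc, h.1, h.2, Or.inl inter_subset_right, Or.inr fun x hx => hx.2⟩
  · have hAc : A ⊆ c ∨ A ⊆ cᶜ := by
      by_cases h1 : (A ∩ c).Nonempty
      · left
        intro x hx
        by_contra hxc
        exact h ⟨h1, x, hx, hxc⟩
      · right
        intro x hx hxc
        exact h1 ⟨x, hx, hxc⟩
    obtain ⟨x, hx⟩ := hne
    obtain ⟨y, hy, hyx⟩ : ∃ y ∈ A, y ≠ x := by
      by_contra! hall
      have : A = {x} := Subset.antisymm (fun y hy => hall y hy) (by simpa using hx)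
      exact hK x (this ▸ hA.isOpen)
    obtain ⟨T, hT, hxT, hTy⟩ := compact_exists_isClopen_in_isOpen
      (isOpen_compl_singleton (x := y)) (show x ∈ ({y} : Set K)ᶜ from fun h => hyx h.symm)
    refine ⟨T, hT, ⟨x, hx, hxT⟩, ⟨y, hy, fun h => hTy h rfl⟩, ?_, ?_⟩
    · exact hAc.imp inter_subset_left.trans inter_subset_left.trans
    · exact hAc.imp sdiff_subset.trans sdiff_subset.trans

theorem exists_seq_isClopen_separating (K : Type*) [TopologicalSpace K] [CompactSpace K]
    [T2Space K] [SecondCountableTopology K] [TotallyDisconnectedSpace K] :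
    ∃ c : ℕ → Set K, (∀ n, IsClopen (c n)) ∧ ∀ x y, (∀ n, x ∈ c n ↔ y ∈ c n) → x = y := by
  obtain ⟨B, hBsub, hBc, hB⟩ := (isTopologicalBasis_isClopen (X := K)).exists_countable
  obtain ⟨c, hc⟩ := (hBc.insert ∅).exists_eq_range (insert_nonempty _ _)
  have hmem : ∀ n, c n ∈ insert ∅ B := fun n => hc ▸ mem_range_self n
  refine ⟨c, fun n => ?_, fun x y h => ?_⟩
  · rcases hmem n with h | h
    · rw [h]; exact isClopen_empty
    · exact hBsub h
  · by_contra hxy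
    obtain ⟨s, hs, hxs, hsy⟩ := hB.exists_subset_of_mem_open
      (show x ∈ ({y} : Set K)ᶜ from hxy) isOpen_compl_singleton
    obtain ⟨n, rfl⟩ : s ∈ range c := hc ▸ mem_insert_of_mem _ hs
    exact hsy ((h n).1 hxs) rfl

/-- **Brouwer's characterization of the Cantor space**. -/
theorem nonempty_homeomorph_nat_bool {K : Type*} [TopologicalSpace K] [CompactSpace K]
    [T2Space K] [SecondCountableTopology K] [TotallyDisconnectedSpace K] [Nonempty K]
    (hK : ∀ x : K, ¬ IsOpen ({x} : Set K)) : Nonempty (K ≃ₜ (ℕ → Bool)) := by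
  classical
  obtain ⟨c, hc, hsep⟩ := exists_seq_isClopen_separating K
  let P := {A : Set K // IsClopen A ∧ A.Nonempty}
  choose T hT hin hout hcin hcout using fun (A : P) (n : ℕ) =>
    A.2.1.exists_splitting hK A.2.2 (hc n)
  -- A binary tree of nonempty clopen sets, newest bit at the head. Each set of level `n + 1` lies
  -- on one side of `c n`, so a branch meets in at most one point.
  let A : List Bool → P := fun l => List.rec ⟨univ, isClopen_univ, univ_nonempty⟩
    (fun b l A => bif b then ⟨A.1 ∩ T A l.length, A.2.1.inter (hT _ _), hin _ _⟩
      else ⟨A.1 \ T A l.length, A.2.1.diff (hT _ _), hout _ _⟩) l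
  have hAt : ∀ l, (A (true :: l)).1 = (A l).1 ∩ T (A l) l.length := fun l => rfl
  have hAf : ∀ l, (A (false :: l)).1 = (A l).1 \ T (A l) l.length := fun l => rfl
  have hmem : ∀ b l x, x ∈ (A (b :: l)).1 ↔ x ∈ (A l).1 ∧ decide (x ∈ T (A l) l.length) = b := by
    rintro (_ | _) l x
    · rw [hAf]; simp
    · rw [hAt]; simp
  -- The unique node of level `n` containing `x`; `β x` is the branch it traces.
  let L : ℕ → K → List Bool := fun n x =>
    Nat.rec [] (fun n l => decide (x ∈ T (A l) n) :: l) n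
  let β : K → ℕ → Bool := fun x n => decide (x ∈ T (A (L n x)) n)
  have hLs : ∀ n x, L (n + 1) x = β x n :: L n x := fun n x => rfl
  have hlen : ∀ n x, (L n x).length = n := by
    intro n x
    induction n with
    | zero => rfl
    | succ n ih => rw [hLs, List.length_cons, ih]
  have hLmem : ∀ n x, x ∈ (A (L n x)).1 := by
    intro n x
    induction n with
    | zero => exact mem_univ x
    | succ n ih =>
      rw [hLs, hmem, hlen]
      exact ⟨ih, rfl⟩
  have huniq : ∀ n x l, l.length = n → x ∈ (A l).1 → L n x = l := by
    intro n x
    induction n with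
    | zero => intro l hl _; exact (List.length_eq_zero_iff.1 hl).symm
    | succ n ih =>
      rintro (_ | ⟨b, l⟩) hl hx
      · simp at hl
      · have hl' : l.length = n := by simpa using hl
        rw [hmem, hl'] at hx
        have := ih l hl' hx.1
        rw [hLs, this, ← hx.2]
        simp only [β, this]
  have hcont : Continuous β := by
    refine continuous_pi fun n => continuous_iff_continuousAt.2 fun x => ?_
    have h1 : ∀ᶠ y in 𝓝 x, y ∈ (A (L n x)).1 := (A (L n x)).2.1.isOpen.mem_nhds (hLmem n x)
    have h2 : ∀ᶠ y in 𝓝 x, (y ∈ T (A (L n x)) n ↔ x ∈ T (A (L n x)) n) := by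
      by_cases hx : x ∈ T (A (L n x)) n
      · filter_upwards [(hT (A (L n x)) n).isOpen.mem_nhds hx] with y hy
        exact iff_of_true hy hx
      · filter_upwards [(hT (A (L n x)) n).compl.isOpen.mem_nhds hx] with y hy
        exact iff_of_false hy hx
    refine ContinuousAt.congr (f := fun _ => β x n) continuousAt_const ?_
    filter_upwards [h1, h2] with y hy1 hy2
    have := huniq n y _ (hlen n x) hy1
    simp only [β, this, hy2]
  have hLeq : ∀ x y, β x = β y → ∀ n, L n x = L n y := by
    intro x y h n
    induction n with
    | zero => rfl
    | succ n ih => rw [hLs, hLs, ih, h]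
  have hinj : Function.Injective β := by
    intro x y h
    refine hsep x y fun n => ?_
    have hx := hLmem (n + 1) x
    have hy := hLmem (n + 1) y
    rw [← hLeq x y h (n + 1)] at hy
    have key : (A (L (n + 1) x)).1 ⊆ c n ∨ (A (L (n + 1) x)).1 ⊆ (c n)ᶜ := by
      rw [hLs]
      cases β x n
      · rw [hAf, hlen]; exact hcout _ _
      · rw [hAt, hlen]; exact hcin _ _
    rcases key with key | key
    · exact iff_of_true (key hx) (key hy)
    · exact iff_of_false (key hx) (key hy)
  have hsurj : Function.Surjective β := by
    intro s
    have hstep : ∀ n, (A (PiNat.res s (n + 1))).1 ⊆ (A (PiNat.res s n)).1 := by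
      intro n x hx
      rw [PiNat.res_succ, hmem] at hx
      exact hx.1
    obtain ⟨x, hx⟩ := IsCompact.nonempty_iInter_of_sequence_nonempty_isCompact_isClosed
      (fun n => (A (PiNat.res s n)).1) hstep (fun n => (A _).2.2)
      (A (PiNat.res s 0)).2.1.isClosed.isCompact (fun n => (A _).2.1.isClosed)
    rw [mem_iInter] at hx
    refine ⟨x, funext fun n => ?_⟩
    have h1 := hx (n + 1)
    rw [PiNat.res_succ, hmem, PiNat.res_length] at h1
    have := huniq n x _ (PiNat.res_length s n) h1.1
    rw [← h1.2]
    simp only [β, this]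
  exact ⟨Continuous.homeoOfEquivCompactToT2 (f := Equiv.ofBijective β ⟨hinj, hsurj⟩) hcont⟩

end CantorSpaceCharacterization

/-! ### Generic behaviour of selections of suitable relations. -/

section Residual

open Filter Topology

/-- The complement of `U` is a proper closed set, so by irreducibility its image omits a point; `V`
is the complement of that image. -/
theorem IsIrreducibleMap.exists_preimage_subset {E X : Type*} [TopologicalSpace E]
    [TopologicalSpace X] [CompactSpace E] [T2Space X] {f : E → X} (hf : IsIrreducibleMap f)
    {U : Set E} (hU : IsOpen U) (hne : U.Nonempty) :
    ∃ V : Set X, IsOpen V ∧ V.Nonempty ∧ f ⁻¹' V ⊆ U := by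
  refine ⟨(f '' Uᶜ)ᶜ, ?_, ?_, ?_⟩
  · exact (hU.isClosed_compl.isCompact.image hf.continuous).isClosed.isOpen_compl
  · rw [nonempty_compl]
    intro h
    have := hf.minimal.2 ⟨hU.isClosed_compl, h⟩ (subset_univ _)
    obtain ⟨x, hx⟩ := hne
    exact this (mem_univ x) hx
  · intro x hx
    by_contra hxU
    exact hx ⟨x, hxU, rfl⟩

variable {X Y : Type*}

theorem IsSuitable.exists_mem [TopologicalSpace X] [TopologicalSpace Y] {F : SetRel X Y}
    (hF : IsSuitable F) (x : X) : ∃ y, (x, y) ∈ F := by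
  obtain ⟨⟨⟨x', y⟩, h⟩, rfl⟩ := hF.irreducible_fst.surjective x
  exact ⟨y, h⟩

/-- Upper semicontinuity: projection along a compact factor is a closed map. -/
theorem IsClosed.isOpen_setOf_image_subset [TopologicalSpace X] [TopologicalSpace Y]
    [CompactSpace Y] {F : Set (X × Y)} (hF : IsClosed F) {W : Set Y} (hW : IsOpen W) :
    IsOpen {x | ∀ y, (x, y) ∈ F → y ∈ W} := by
  have : {x | ∀ y, (x, y) ∈ F → y ∈ W} = (Prod.fst '' (F ∩ Prod.snd ⁻¹' Wᶜ))ᶜ := by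
    ext x
    simp only [mem_ofPred_eq, mem_compl_iff, mem_image, mem_inter_iff, mem_preimage,
      Prod.exists, not_exists, not_and]
    constructor
    · rintro h a y ⟨h1, h2⟩ rfl
      exact h2 (h y h1)
    · intro h y hy
      by_contra hyW
      exact h x y ⟨hy, hyW⟩ rfl
  rw [this]
  exact (isClosedMap_fst_of_compactSpace _
    (hF.inter (hW.isClosed_compl.preimage continuous_snd))).isOpen_compl

theorem IsSuitable.continuousAt_of_mem_oneSet [TopologicalSpace X] [TopologicalSpace Y]
    [CompactSpace Y] {F : SetRel X Y} (hF : IsSuitable F) {f : X → Y} (hf : ∀ x, (x, f x) ∈ F) {x : X}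
    (hx : x ∈ oneSet F) : ContinuousAt f x := by
  intro N hN
  obtain ⟨W, hWN, hW, hfW⟩ := mem_nhds_iff.1 hN
  refine mem_map.2 (mem_of_superset
    ((hF.isClosed.isOpen_setOf_image_subset hW).mem_nhds ?_) fun a ha => hWN (ha _ (hf a)))
  exact fun y hy => hx.unique (hf x) hy ▸ hfW

/-- If `G • F` is the identity, then a selection of `G` inverts a selection of `F` wherever the
latter lands in the set on which `G` is single-valued. -/
theorem eq_of_suitableComp_eq_id [TopologicalSpace X] [TopologicalSpace Y] {F : SetRel X Y}
    {G : SetRel Y X} (h : suitableComp G F = SetRel.id) {f : X → Y} {g : Y → X}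
    (hf : ∀ x, (x, f x) ∈ F) (hg : ∀ y, (y, g y) ∈ G) {x : X} (hx : f x ∈ oneSet G) :
    g (f x) = x := by
  have : (x, g (f x)) ∈ suitableComp G F :=
    ⟨(x, f x, g (f x)), subset_closure ⟨⟨hf x, hg _⟩, hx⟩, rfl⟩
  rw [h] at this
  exact (SetRel.mem_id.1 this).symm

variable [TopologicalSpace X] [CompactSpace X] [T2Space X]

/-- Irreducibility of the first projection, applied to the trace of the box `V × W` on `F`, gives an
open set of whole fibres inside the box. -/
theorem IsSuitable.exists_isOpen_image_subset [TopologicalSpace Y] [CompactSpace Y]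
    {F : SetRel X Y} (hF : IsSuitable F) {V : Set X} {W : Set Y} (hV : IsOpen V) (hW : IsOpen W)
    {x : X} {y : Y} (hx : x ∈ V) (hy : y ∈ W) (hxy : (x, y) ∈ F) :
    ∃ V' ⊆ V, IsOpen V' ∧ V'.Nonempty ∧ ∀ x ∈ V', ∀ y, (x, y) ∈ F → y ∈ W := by
  have : CompactSpace ↥F := isCompact_iff_compactSpace.1 hF.isClosed.isCompact
  obtain ⟨V', hV', hne, hsub⟩ := hF.irreducible_fst.exists_preimage_subset
    (U := {p : ↥F | p.1.1 ∈ V ∧ p.1.2 ∈ W})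
    ((hV.preimage (continuous_fst.comp continuous_subtype_val)).inter
      (hW.preimage (continuous_snd.comp continuous_subtype_val))) ⟨⟨(x, y), hxy⟩, hx, hy⟩
  refine ⟨V', fun a ha => ?_, hV', hne, fun a ha b hab => ?_⟩
  · obtain ⟨b, hab⟩ := hF.exists_mem a
    exact (hsub (show (⟨(a, b), hab⟩ : ↥F) ∈ _ from ha)).1
  · exact (hsub (show (⟨(a, b), hab⟩ : ↥F) ∈ _ from ha)).2

/-- A suitable relation is single-valued at the points of a residual set. -/
theorem IsSuitable.oneSet_mem_residual [MetricSpace Y] [CompactSpace Y] {F : SetRel X Y}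
    (hF : IsSuitable F) : oneSet F ∈ residual X := by
  -- Points whose fibre fits in a ball of radius `1 / (n + 1)`; a fibre that does so for every `n`
  -- has only one point.
  let O : ℕ → Set X := fun n =>
    ⋃ z : Y, {x | ∀ y, (x, y) ∈ F → y ∈ Metric.ball z (1 / ((n : ℝ) + 1))}
  have hO : ∀ n, O n ∈ residual X := by
    intro n
    refine residual_of_dense_open
      (isOpen_iUnion fun z => hF.isClosed.isOpen_setOf_image_subset Metric.isOpen_ball) ?_
    rw [dense_iff_inter_open]
    rintro V hV ⟨x, hx⟩
    obtain ⟨y, hy⟩ := hF.exists_mem x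
    obtain ⟨V', hV', -, ⟨a, ha⟩, h⟩ := hF.exists_isOpen_image_subset hV Metric.isOpen_ball hx
      (Metric.mem_ball_self (x := y) (Nat.one_div_pos_of_nat (n := n))) hy
    exact ⟨a, hV' ha, mem_iUnion.2 ⟨y, h a ha⟩⟩
  filter_upwards [countable_iInter_mem.2 hO] with x hx
  obtain ⟨y, hy⟩ := hF.exists_mem x
  refine ⟨y, hy, fun z hz => ?_⟩
  refine dist_le_zero.1 (le_of_forall_pos_lt_add fun ε hε => ?_)
  obtain ⟨n, hn⟩ := exists_nat_one_div_lt (half_pos hε)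
  obtain ⟨w, hw⟩ := mem_iUnion.1 (mem_iInter.1 hx n)
  have h1 := Metric.mem_ball.1 (hw y hy)
  have h2 := Metric.mem_ball.1 (hw z hz)
  have := dist_triangle_right z y w
  linarith

/-- Selections of suitable relations pull residual sets back to residual sets. -/
theorem IsSuitable.tendsto_residual [TopologicalSpace Y] [CompactSpace Y] {F : SetRel X Y}
    (hF : IsSuitable F) {f : X → Y} (hf : ∀ x, (x, f x) ∈ F) :
    Tendsto f (residual X) (residual Y) := by
  intro R hR
  obtain ⟨S, hSo, hSd, hSc, hSR⟩ := mem_residual_iff.1 hR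
  have key : ∀ W ∈ S, f ⁻¹' W ∈ residual X := by
    intro W hW
    refine mem_of_superset (residual_of_dense_open
      (hF.isClosed.isOpen_setOf_image_subset (hSo W hW)) ?_) fun x hx => hx _ (hf x)
    rw [dense_iff_inter_open]
    rintro V hV ⟨x, hx⟩
    -- The part of `F` over `V` projects onto a set with interior, which the dense set `W` must
    -- meet.
    have := hF.almostOpen_snd {p : ↥F | p.1.1 ∈ V}
      (hV.preimage (continuous_fst.comp continuous_subtype_val)) ⟨⟨(x, f x), hf x⟩, hx⟩
    obtain ⟨y, hy1, hyW⟩ := (hSd W hW).inter_open_nonempty _ isOpen_interior this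
    obtain ⟨⟨⟨a, b⟩, hab⟩, ha, rfl⟩ := interior_subset hy1
    obtain ⟨V', hV', -, ⟨a, ha⟩, h⟩ := hF.exists_isOpen_image_subset hV (hSo W hW) ha hyW hab
    exact ⟨a, hV' ha, h a ha⟩
  refine mem_map.2 (mem_of_superset ((countable_bInter_mem hSc).2 key) fun x hx => hSR ?_)
  exact fun W hW => mem_iInter₂.1 hx W hW

/-- The image of a nonempty relatively open piece of a dense set under a selection of a suitable
relation is dense in some nonempty open set. -/
theorem IsSuitable.exists_isOpen_subset_closure_image [TopologicalSpace Y] [CompactSpace Y]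
    {F : SetRel X Y} (hF : IsSuitable F) {f : X → Y} (hf : ∀ x, (x, f x) ∈ F) {D : Set X}
    (hD : Dense D) {V : Set X} (hV : IsOpen V) (hne : V.Nonempty) :
    ∃ O : Set Y, IsOpen O ∧ O.Nonempty ∧ O ⊆ closure (f '' (V ∩ D)) := by
  obtain ⟨x, hx⟩ := hne
  refine ⟨_, isOpen_interior, hF.almostOpen_snd {p : ↥F | p.1.1 ∈ V}
      (hV.preimage (continuous_fst.comp continuous_subtype_val)) ⟨⟨(x, f x), hf x⟩, hx⟩, ?_⟩
  intro y hy
  rw [mem_closure_iff]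
  intro W hW hyW
  obtain ⟨⟨⟨a, b⟩, hab⟩, ha, rfl⟩ := interior_subset hy
  obtain ⟨V', hV', hV'o, hV'ne, h⟩ := hF.exists_isOpen_image_subset hV hW ha hyW hab
  obtain ⟨d, hd, hdD⟩ := hD.inter_open_nonempty V' hV'o hV'ne
  exact ⟨f d, h d hd _ (hf d), d, ⟨hV' hd, hdD⟩, rfl⟩

end Residual

/-! ### Closures of sections over a dense set. -/

section DenseSection

open Filter Topology

variable {X Z : Type*} [TopologicalSpace X] [TopologicalSpace Z]
  {D : Set X} {E : X → Z} {π : Z → X}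

/-- If `E` is a section of `π` over a dense set `D`, continuous at the points of `D`, then `π` is
injective over `D` on the closure of `E(D)`. -/
theorem eq_of_mem_closure_image_section [T2Space Z] (hE : ∀ x ∈ D, ContinuousAt E x)
    (hπ : Continuous π) (hEπ : ∀ x ∈ D, π (E x) = x) {z : Z} (hz : z ∈ closure (E '' D))
    (hzD : π z ∈ D) : E (π z) = z := by
  by_contra hne
  obtain ⟨U, V, hU, hV, hEU, hzV, hUV⟩ := t2_separation hne
  obtain ⟨W, hWU, hW, hzW⟩ := mem_nhds_iff.1 ((hE _ hzD) (hU.mem_nhds hEU))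
  obtain ⟨_, ⟨hdV, hdW⟩, d, hd, rfl⟩ :=
    mem_closure_iff.1 hz (V ∩ π ⁻¹' W) (hV.inter (hW.preimage hπ)) ⟨hzV, hzW⟩
  rw [mem_preimage, hEπ d hd] at hdW
  exact disjoint_left.1 hUV (hWU hdW) hdV

theorem isIrreducibleMap_closure_image_section [T2Space X] [T2Space Z] [CompactSpace Z]
    (hD : Dense D)
    (hE : ∀ x ∈ D, ContinuousAt E x) (hπ : Continuous π) (hEπ : ∀ x ∈ D, π (E x) = x) :
    IsIrreducibleMap (fun z : closure (E '' D) => π z) := by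
  have hsurj : π '' closure (E '' D) = univ := by
    have hcl : IsClosed (π '' closure (E '' D)) := (isClosed_closure.isCompact.image hπ).isClosed
    refine eq_univ_of_univ_subset ?_
    rw [← hD.closure_eq]
    exact hcl.closure_subset_iff.2 fun x hx =>
      ⟨E x, subset_closure ⟨x, hx, rfl⟩, hEπ x hx⟩
  refine ⟨hπ.comp continuous_subtype_val, fun x => ?_, ⟨isClosed_univ, ?_⟩, ?_⟩
  · obtain ⟨z, hz, rfl⟩ := hsurj.ge (mem_univ x)
    exact ⟨⟨z, hz⟩, rfl⟩
  · rw [image_univ]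
    refine eq_univ_of_forall fun x => ?_
    obtain ⟨z, hz, rfl⟩ := hsurj.ge (mem_univ x)
    exact ⟨⟨z, hz⟩, rfl⟩
  · rintro A ⟨hA, hAX⟩ - ⟨z, hz⟩ -
    -- Over a point `d` of `D` the only point of the closure is `E d`, so a closed set mapping onto
    -- `X` contains all of `E(D)`.
    have hEA : E '' D ⊆ Subtype.val '' A := by
      rintro _ ⟨d, hd, rfl⟩
      obtain ⟨⟨w, hw⟩, hwA, rfl⟩ := hAX.ge (mem_univ d)
      exact ⟨⟨w, hw⟩, hwA, (eq_of_mem_closure_image_section hE hπ hEπ hw hd).symm⟩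
    have := (isClosed_closure.isClosedEmbedding_subtypeVal.isClosedMap A hA).closure_subset_iff.2
      hEA hz
    obtain ⟨w, hw, rfl⟩ := this
    exact hw

/-- An isolated point would be some `E d`; continuity at `d` and density of `D` would then isolate
`d` in `X`. -/
theorem not_isOpen_singleton_closure_image_section [T1Space X]
    (hX : ∀ x : X, ¬ IsOpen ({x} : Set X)) (hD : Dense D) (hE : ∀ x ∈ D, ContinuousAt E x)
    (hEπ : ∀ x ∈ D, π (E x) = x) (z : closure (E '' D)) :
    ¬ IsOpen ({z} : Set (closure (E '' D))) := by
  intro hz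
  obtain ⟨U, hU, hUz⟩ := isOpen_induced_iff.1 hz
  have hUmem : ∀ w ∈ closure (E '' D), w ∈ U → w = z := fun w hw hwU =>
    congrArg Subtype.val (hUz.le (show (⟨w, hw⟩ : closure (E '' D)) ∈ _ from hwU))
  have hzU : z.1 ∈ U := hUz.ge rfl
  obtain ⟨_, hdU, d, hd, rfl⟩ := mem_closure_iff.1 z.2 U hU hzU
  obtain ⟨W, hWU, hW, hdW⟩ := mem_nhds_iff.1 (hE d hd (hU.mem_nhds hdU))
  have hWD : ∀ x ∈ W ∩ D, x = d := by
    rintro x ⟨hxW, hxD⟩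
    have h1 := hUmem _ (subset_closure ⟨x, hxD, rfl⟩) (hWU hxW)
    have h2 := hUmem _ (subset_closure ⟨d, hd, rfl⟩) hdU
    rw [← hEπ x hxD, h1, ← h2, hEπ d hd]
  refine hX d ?_
  convert hW using 1
  refine Subset.antisymm (singleton_subset_iff.2 hdW) fun x hx => ?_
  by_contra hxd
  obtain ⟨y, ⟨hyW, hyd⟩, hyD⟩ := hD.inter_open_nonempty (W ∩ {d}ᶜ)
    (hW.inter isOpen_compl_singleton) ⟨x, hx, hxd⟩
  exact hyd (hWD y ⟨hyW, hyD⟩)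

/-- A continuous extension to the closure of `E(D)` of a map of `D` which sends nonempty open
sets to somewhere dense sets is almost open. -/
theorem isAlmostOpen_closure_image_section [T2Space X] [T2Space Z] [CompactSpace Z]
    (hD : Dense D)
    (hE : ∀ x ∈ D, ContinuousAt E x) (hπ : Continuous π) (hEπ : ∀ x ∈ D, π (E x) = x)
    {f : X → X}
    (hf : ∀ V : Set X, IsOpen V → V.Nonempty →
      ∃ O : Set X, IsOpen O ∧ O.Nonempty ∧ O ⊆ closure (f '' (V ∩ D)))
    {g : closure (E '' D) → closure (E '' D)} (hg : Continuous g)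
    (hgE : ∀ z, ∀ x ∈ D, z.1 = E x → (g z).1 = E (f x)) : IsAlmostOpen g := by
  have hC : CompactSpace (closure (E '' D)) :=
    isCompact_iff_compactSpace.1 isClosed_closure.isCompact
  rintro U hU ⟨z, hz⟩
  -- Shrinking to a closed neighbourhood makes the image `g '' K` closed, so density arguments
  -- suffice.
  obtain ⟨K, hKz, hK, hKU⟩ := exists_mem_nhds_isClosed_subset (hU.mem_nhds hz)
  obtain ⟨N, hN, hNK⟩ := mem_nhds_subtype _ _ _ |>.1 hKz
  obtain ⟨N', hN'N, hN', hzN'⟩ := mem_nhds_iff.1 hN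
  obtain ⟨_, hdN, d, hd, rfl⟩ := mem_closure_iff.1 z.2 N' hN' hzN'
  obtain ⟨W, hWN, hW, hdW⟩ := mem_nhds_iff.1 (hE d hd (hN'.mem_nhds hdN))
  obtain ⟨O, hO, ⟨o, ho⟩, hOW⟩ := hf W hW ⟨d, hdW⟩
  -- Points `E a` with `a ∈ D ∩ O` are dense here. Such an `a` is a limit of `f x` with `x ∈ W ∩ D`,
  -- so by continuity of `E` at `a` it suffices that `E (f x) = g (E x)` lies in `g '' K`.
  have hsub : {w : closure (E '' D) | π w ∈ O} ⊆ g '' K := by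
    intro w hw
    have hcl : IsClosed (g '' K) := (hK.isCompact.image hg).isClosed
    rw [← hcl.closure_eq, mem_closure_iff]
    intro M hM hwM
    obtain ⟨M', hM', rfl⟩ := isOpen_induced_iff.1 hM
    obtain ⟨_, ⟨haM, haO⟩, a, ha, rfl⟩ := mem_closure_iff.1 w.2 (M' ∩ π ⁻¹' O)
      (hM'.inter (hO.preimage hπ)) ⟨hwM, hw⟩
    rw [mem_preimage, hEπ a ha] at haO
    obtain ⟨_, hxM, x, ⟨hxW, hxD⟩, rfl⟩ := mem_closure_iff_nhds.1 (hOW haO) _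
      (hE a ha (hM'.mem_nhds haM))
    have hxC : E x ∈ closure (E '' D) := subset_closure ⟨x, hxD, rfl⟩
    refine ⟨g ⟨E x, hxC⟩, ?_, ⟨E x, hxC⟩, hNK (hN'N (hWN hxW)), rfl⟩
    rw [mem_preimage, hgE _ x hxD rfl]
    exact hxM
  obtain ⟨w, hw⟩ := (isIrreducibleMap_closure_image_section hD hE hπ hEπ).surjective o
  exact ⟨w, interior_maximal (hsub.trans (image_mono hKU))
    (hO.preimage (hπ.comp continuous_subtype_val)) (show π w ∈ O from (show π w = o from hw).symm ▸ ho)⟩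

end DenseSection

/-! ### Itineraries and total disconnectedness. -/

section OrbitCode

open Filter Topology

variable {X : Type*}

open Classical in
/-- The itinerary of a point with respect to a sequence of sets. -/
noncomputable def bitCode (b : ℕ → Set X) (x : X) : ℕ → Bool := fun k => decide (x ∈ b k)

/-- The code of a point recording its images under a family of maps together with their
itineraries. -/
noncomputable def orbitCode {ι : Type*} (b : ℕ → Set X) (φ : ι → X → X) (x : X) :
    ι → (ℕ → Bool) × X :=
  fun i => (bitCode b (φ i x), φ i x)

variable [TopologicalSpace X]

theorem continuousAt_bitCode {b : ℕ → Set X} {x : X} (hx : ∀ k, x ∉ frontier (b k)) :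
    ContinuousAt (bitCode b) x := by
  refine continuousAt_pi.2 fun k => ?_
  refine ContinuousAt.congr (f := fun _ => bitCode b x k) continuousAt_const ?_
  by_cases h : x ∈ interior (b k)
  · filter_upwards [isOpen_interior.mem_nhds h] with y hy
    simp [bitCode, interior_subset hy, interior_subset h]
  · have h' : x ∉ closure (b k) := fun hc => hx k ⟨hc, h⟩
    filter_upwards [isClosed_closure.isOpen_compl.mem_nhds h'] with y hy
    simp [bitCode, show y ∉ b k from fun h => hy (subset_closure h),
      show x ∉ b k from fun h => h' (subset_closure h)]

theorem continuousAt_orbitCode {ι : Type*} {b : ℕ → Set X} {φ : ι → X → X} {x : X}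
    (hφ : ∀ i, ContinuousAt (φ i) x) (hx : ∀ i k, φ i x ∉ frontier (b k)) :
    ContinuousAt (orbitCode b φ) x :=
  continuousAt_pi.2 fun i =>
    ((continuousAt_bitCode (hx i)).comp (hφ i)).prodMk (hφ i)

theorem exists_seq_isOpen_separating (X : Type*) [TopologicalSpace X] [T3Space X]
    [SecondCountableTopology X] : ∃ b : ℕ → Set X, (∀ k, IsOpen (b k)) ∧
      ∀ x y, x ≠ y → ∃ k, x ∈ b k ∧ y ∉ closure (b k) := by
  obtain ⟨b, hb⟩ := ((TopologicalSpace.countable_countableBasis X).insert ∅).exists_eq_range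
    (insert_nonempty _ _)
  refine ⟨b, fun k => ?_, fun x y hxy => ?_⟩
  · rcases hb.ge (mem_range_self k) with h | h
    · rw [h]; exact isOpen_empty
    · exact TopologicalSpace.isOpen_of_mem_countableBasis h
  · obtain ⟨K, hKx, hK, hKy⟩ := exists_mem_nhds_isClosed_subset
      (isOpen_compl_singleton.mem_nhds (show x ∈ ({y} : Set X)ᶜ from hxy))
    obtain ⟨s, hs, hxs, hsK⟩ := (TopologicalSpace.isBasis_countableBasis X).mem_nhds_iff.1 hKx
    obtain ⟨k, rfl⟩ := hb.le (mem_insert_of_mem _ hs)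
    exact ⟨k, hxs, fun h => hKy (hK.closure_subset_iff.2 hsK h) rfl⟩

/-- In the closure a bit is still forced to be true over `b k` and false off `closure (b k)`.
Separation then makes the map to the bits a continuous injection into a Cantor cube. -/
theorem totallyDisconnectedSpace_closure_image_orbitCode {ι : Type*} {b : ℕ → Set X}
    (hbo : ∀ k, IsOpen (b k)) (hb : ∀ x y, x ≠ y → ∃ k, x ∈ b k ∧ y ∉ closure (b k))
    (φ : ι → X → X) (D : Set X) :
    TotallyDisconnectedSpace (closure (orbitCode b φ '' D)) := by
  have hbit : ∀ (i : ι) (k : ℕ), Continuous fun z : ι → (ℕ → Bool) × X => (z i).1 k :=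
    fun i k => by fun_prop
  have hpt : ∀ i : ι, Continuous fun z : ι → (ℕ → Bool) × X => (z i).2 := fun i => by fun_prop
  have htrue : ∀ z ∈ closure (orbitCode b φ '' D), ∀ i k, (z i).2 ∈ b k → (z i).1 k = true := by
    intro z hz i k hzk
    by_contra hf
    obtain ⟨_, ⟨h1, h2⟩, d, -, rfl⟩ := mem_closure_iff.1 hz _
      (((hbo k).preimage (hpt i)).inter ((isOpen_discrete {true}ᶜ).preimage (hbit i k)))
      ⟨hzk, hf⟩
    exact h2 (by simpa [orbitCode, bitCode] using h1)
  have hfalse : ∀ z ∈ closure (orbitCode b φ '' D), ∀ i k, (z i).2 ∉ closure (b k) →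
      (z i).1 k = false := by
    intro z hz i k hzk
    by_contra hf
    obtain ⟨_, ⟨h1, h2⟩, d, -, rfl⟩ := mem_closure_iff.1 hz _
      ((isClosed_closure.isOpen_compl.preimage (hpt i)).inter
        ((isOpen_discrete {false}ᶜ).preimage (hbit i k))) ⟨hzk, hf⟩
    exact h2 (by simpa [orbitCode, bitCode] using fun h => h1 (subset_closure h))
  refine ⟨isTotallyDisconnected_of_image
    (f := fun (z : closure (orbitCode b φ '' D)) (i : ι) => (z.1 i).1)
    (Continuous.continuousOn (continuous_pi fun i => continuous_fst.comp
      ((continuous_apply i).comp continuous_subtype_val))) ?_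
    (isTotallyDisconnected_of_totallyDisconnectedSpace _)⟩
  rintro ⟨z, hz⟩ ⟨w, hw⟩ h
  refine Subtype.ext (funext fun i => Prod.ext (congrFun h i) ?_)
  by_contra hne
  obtain ⟨k, h1, h2⟩ := hb _ _ hne
  have := congrFun (congrFun h i) k
  simp only [htrue z hz i k h1, hfalse w hw i k h2, Bool.true_eq_false] at this

end OrbitCode

/-! ### Invariance under conjugation by a homeomorphism. -/

section Transport

variable {C K X : Type*} [TopologicalSpace C] [TopologicalSpace K]

theorem MapsRel.conj_homeomorph {h : C → X} {g : C → C} {F : SetRel X X}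
    (hF : MapsRel h (Function.graph g) F) (e : K ≃ₜ C) :
    MapsRel (h ∘ e) (Function.graph (e.symm ∘ g ∘ e)) F := by
  rintro _ ⟨⟨x, y⟩, rfl, rfl⟩
  exact hF ⟨(e x, g (e x)), rfl, by simp⟩

variable [TopologicalSpace X]

theorem IsIrreducibleMap.comp_homeomorph {h : C → X} (hh : IsIrreducibleMap h) (e : K ≃ₜ C) :
    IsIrreducibleMap (h ∘ e) := by
  refine ⟨hh.continuous.comp e.continuous, hh.surjective.comp e.surjective,
    ⟨isClosed_univ, ?_⟩, ?_⟩
  · rw [image_univ, (hh.surjective.comp e.surjective).range_eq]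
  · rintro A ⟨hA, hAX⟩ - x -
    rw [image_comp] at hAX
    have := hh.minimal.2 ⟨e.isClosedMap A hA, hAX⟩ (subset_univ _) (mem_univ (e x))
    obtain ⟨y, hy, hyx⟩ := this
    exact e.injective hyx ▸ hy

theorem IsAlmostOpen.conj_homeomorph {g : C → C} (hg : IsAlmostOpen g) (e : K ≃ₜ C) :
    IsAlmostOpen (e.symm ∘ g ∘ e) := by
  intro U hU hne
  rw [image_comp, image_comp, ← e.symm.image_interior]
  exact (hg _ (e.isOpenMap U hU) (hne.image e)).image _

end Transport

/-! ### Construction of the lifts. -/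

section Main

open Filter Topology

theorem nonempty_homeomorph_closure_image_orbitCode {X : Type*} [TopologicalSpace X]
    [CompactSpace X] [T2Space X] [SecondCountableTopology X] [Nonempty X]
    (hX : ∀ x : X, ¬ IsOpen ({x} : Set X)) {ι : Type*} [Countable ι] {b : ℕ → Set X}
    (hbo : ∀ k, IsOpen (b k)) (hb : ∀ x y, x ≠ y → ∃ k, x ∈ b k ∧ y ∉ closure (b k))
    {φ : ι → X → X} {i₀ : ι} (hφ₀ : ∀ x, φ i₀ x = x) {D : Set X} (hD : Dense D)
    (hE : ∀ x ∈ D, ContinuousAt (orbitCode b φ) x) :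
    Nonempty (cantorSet ≃ₜ closure (orbitCode b φ '' D)) := by
  have : CompactSpace (closure (orbitCode b φ '' D)) :=
    isCompact_iff_compactSpace.1 isClosed_closure.isCompact
  have : Nonempty (closure (orbitCode b φ '' D)) :=
    (hD.nonempty.image _).closure.to_subtype
  have := totallyDisconnectedSpace_closure_image_orbitCode hbo hb φ D
  obtain ⟨e⟩ := nonempty_homeomorph_nat_bool (not_isOpen_singleton_closure_image_section
    (π := fun z => (z i₀).2) hX hD hE fun x _ => hφ₀ x)
  exact ⟨cantorSetHomeomorphNatToBool.trans e.symm⟩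

theorem compl_frontier_mem_residual {X : Type*} [TopologicalSpace X] {U : Set X}
    (hU : IsOpen U) : (frontier U)ᶜ ∈ residual X := by
  refine residual_of_dense_open isClosed_frontier.isOpen_compl ?_
  rw [← interior_eq_empty_iff_dense_compl, ← frontier_compl]
  exact interior_frontier hU.isClosed_compl

/-- The condition `(π z, π (σ z)) ∈ F` is closed and holds on `E(D)`. -/
theorem mapsRel_graph_closure_image {X Z : Type*} [TopologicalSpace X] [TopologicalSpace Z]
    {F : SetRel X X} (hF : IsClosed F) {D : Set X} {E : X → Z} {π : Z → X} (hπ : Continuous π)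
    (hEπ : ∀ x, π (E x) = x) {f : X → X} (hf : ∀ x, (x, f x) ∈ F) {σ : Z → Z}
    (hσ : Continuous σ) (hσE : ∀ x ∈ D, σ (E x) = E (f x))
    {g : closure (E '' D) → closure (E '' D)} (hg : ∀ z, (g z).1 = σ z) :
    MapsRel (fun z : closure (E '' D) => π z) (Function.graph g) F := by
  rintro _ ⟨⟨z, w⟩, rfl, rfl⟩
  have hcl : IsClosed {z : Z | (π z, π (σ z)) ∈ F} :=
    hF.preimage (hπ.prodMk (hπ.comp hσ))
  have : closure (E '' D) ⊆ {z : Z | (π z, π (σ z)) ∈ F} := by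
    refine hcl.closure_subset_iff.2 ?_
    rintro _ ⟨d, hd, rfl⟩
    rw [mem_ofPred_eq, hσE d hd, hEπ, hEπ]
    exact hf d
  simpa [hg] using this z.2

variable {X : Type*} [MetricSpace X] [CompactSpace X] [Nonempty X]

theorem IsSuitable.exists_cantorSet_lift (hX : ∀ x : X, ¬ IsOpen ({x} : Set X)) {F : SetRel X X}
    (hF : IsSuitable F) : ∃ (g : cantorSet → cantorSet) (h : cantorSet → X),
      Continuous g ∧ IsAlmostOpen g ∧ IsIrreducibleMap h ∧
        MapsRel h (Function.graph g) F := by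
  choose f hf using hF.exists_mem
  obtain ⟨b, hbo, hb⟩ := exists_seq_isOpen_separating X
  let D : Set X := {x | ∀ n : ℕ, f^[n] x ∈ oneSet F ∧ ∀ k, f^[n] x ∉ frontier (b k)}
  have hD : Dense D := by
    refine dense_of_mem_residual (eventually_countable_forall.2 fun n => ?_)
    exact ((hF.tendsto_residual hf).iterate n).eventually (p := fun x => _ ∧ ∀ k, _)
      (inter_mem hF.oneSet_mem_residual
        (eventually_countable_forall.2 fun k => compl_frontier_mem_residual (hbo k)))
  have hfD : MapsTo f D D := fun x hx n => hx (n + 1)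
  have hcont : ∀ x ∈ D, ∀ n : ℕ, ContinuousAt f^[n] x := by
    intro x hx n
    induction n with
    | zero => exact continuousAt_id
    | succ n ih =>
      rw [Function.iterate_succ']
      exact (hF.continuousAt_of_mem_oneSet hf (hx n).1).comp ih
  let φ : ℕ → X → X := fun n => f^[n]
  have hE : ∀ x ∈ D, ContinuousAt (orbitCode b φ) x := fun x hx =>
    continuousAt_orbitCode (hcont x hx) fun n => (hx n).2
  let π : (ℕ → (ℕ → Bool) × X) → X := fun z => (z 0).2
  have hπ : Continuous π := by fun_prop
  have hEπ : ∀ x, π (orbitCode b φ x) = x := fun x => rfl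
  let σ : (ℕ → (ℕ → Bool) × X) → (ℕ → (ℕ → Bool) × X) := fun z n => z (n + 1)
  have hσ : Continuous σ := continuous_pi fun n => continuous_apply (n + 1)
  have hσE : ∀ x, σ (orbitCode b φ x) = orbitCode b φ (f x) := fun x => rfl
  have hmaps : MapsTo σ (closure (orbitCode b φ '' D)) (closure (orbitCode b φ '' D)) := by
    refine MapsTo.closure ?_ hσ
    rintro _ ⟨x, hx, rfl⟩
    exact ⟨f x, hfD hx, rfl⟩
  obtain ⟨e⟩ := nonempty_homeomorph_closure_image_orbitCode hX hbo hb (i₀ := 0) hEπ hD hE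
  have hgc : Continuous (hmaps.restrict σ _ _) := hσ.restrict hmaps
  refine ⟨e.symm ∘ hmaps.restrict σ _ _ ∘ e, (fun z => π z.1) ∘ e,
    e.symm.continuous.comp (hgc.comp e.continuous),
    IsAlmostOpen.conj_homeomorph ?_ e, IsIrreducibleMap.comp_homeomorph ?_ e,
    MapsRel.conj_homeomorph ?_ e⟩
  · refine isAlmostOpen_closure_image_section hD hE hπ (fun x _ => hEπ x)
      (fun V hV hne => hF.exists_isOpen_subset_closure_image hf hD hV hne) hgc ?_
    intro z x _ hz
    rw [MapsTo.val_restrict_apply, hz, hσE]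
  · exact isIrreducibleMap_closure_image_section hD hE hπ fun x _ => hEπ x
  · exact mapsRel_graph_closure_image hF.isClosed hπ hEπ hf hσ (fun x _ => hσE x)
      fun z => rfl

/-- The two-sided iterates of a map `f` with prospective inverse `g`. -/
def zIterate {X : Type*} (f g : X → X) : ℤ → X → X
  | Int.ofNat n => f^[n]
  | Int.negSucc n => g^[n + 1]

theorem zIterate_succ {X : Type*} {f g : X → X} {x : X} (h : g (f x) = x) (i : ℤ) :
    zIterate f g i (f x) = zIterate f g (i + 1) x := by
  rcases i with n | n | n
  · rfl
  · exact h
  · change g^[n + 1] (g (f x)) = g^[n + 1] x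
    rw [h]

theorem IsSuitableIso.exists_cantorSet_lift (hX : ∀ x : X, ¬ IsOpen ({x} : Set X))
    {F : SetRel X X} (hiso : IsSuitableIso F) :
    ∃ (g : cantorSet ≃ₜ cantorSet) (h : cantorSet → X),
      IsIrreducibleMap h ∧ MapsRel h (Function.graph g) F := by
  obtain ⟨hF, G, hG, hGF, hFG⟩ := hiso
  choose f hf using hF.exists_mem
  choose g hg using hG.exists_mem
  obtain ⟨b, hbo, hb⟩ := exists_seq_isOpen_separating X
  let R : Set X := {x | (x ∈ oneSet F ∧ x ∈ oneSet G) ∧ ∀ k, x ∉ frontier (b k)}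
  have hR : R ∈ residual X :=
    inter_mem (inter_mem hF.oneSet_mem_residual hG.oneSet_mem_residual)
      (eventually_countable_forall.2 fun k => compl_frontier_mem_residual (hbo k))
  -- The case `n = 1` puts `f x` in `oneSet G` and `g x` in `oneSet F`, exactly what makes `f` and
  -- `g` mutually inverse on `D`.
  let D : Set X := {x | ∀ n : ℕ, f^[n] x ∈ R ∧ g^[n] x ∈ R}
  have hD : Dense D := by
    refine dense_of_mem_residual (eventually_countable_forall.2 fun n => ?_)
    exact (((hF.tendsto_residual hf).iterate n).eventually hR).and
      (((hG.tendsto_residual hg).iterate n).eventually hR)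
  have hgf : ∀ x ∈ D, g (f x) = x := fun x hx =>
    eq_of_suitableComp_eq_id hGF hf hg (hx 1).1.1.2
  have hfg : ∀ x ∈ D, f (g x) = x := fun x hx =>
    eq_of_suitableComp_eq_id hFG hg hf (hx 1).2.1.1
  have hfD : MapsTo f D D := by
    refine fun x hx n => ⟨(hx (n + 1)).1, ?_⟩
    cases n with
    | zero => exact (hx 1).1
    | succ n =>
      rw [Function.iterate_succ_apply, hgf x hx]
      exact (hx n).2
  have hgD : MapsTo g D D := by
    refine fun x hx n => ⟨?_, (hx (n + 1)).2⟩
    cases n with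
    | zero => exact (hx 1).2
    | succ n =>
      rw [Function.iterate_succ_apply, hfg x hx]
      exact (hx n).1
  let φ : ℤ → X → X := zIterate f g
  have hφR : ∀ x ∈ D, ∀ i, φ i x ∈ R := by
    rintro x hx (n | n)
    · exact (hx n).1
    · exact (hx (n + 1)).2
  have hcontf : ∀ x ∈ D, ∀ n : ℕ, ContinuousAt f^[n] x := by
    intro x hx n
    induction n with
    | zero => exact continuousAt_id
    | succ n ih =>
      rw [Function.iterate_succ']
      exact (hF.continuousAt_of_mem_oneSet hf (hx n).1.1.1).comp ih
  have hcontg : ∀ x ∈ D, ∀ n : ℕ, ContinuousAt g^[n] x := by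
    intro x hx n
    induction n with
    | zero => exact continuousAt_id
    | succ n ih =>
      rw [Function.iterate_succ']
      exact (hG.continuousAt_of_mem_oneSet hg (hx n).2.1.2).comp ih
  have hE : ∀ x ∈ D, ContinuousAt (orbitCode b φ) x := by
    refine fun x hx => continuousAt_orbitCode ?_ fun i => (hφR x hx i).2
    rintro (n | n)
    · exact hcontf x hx n
    · exact hcontg x hx (n + 1)
  let π : (ℤ → (ℕ → Bool) × X) → X := fun z => (z 0).2
  have hπ : Continuous π := by fun_prop
  have hEπ : ∀ x, π (orbitCode b φ x) = x := fun x => rfl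
  let σ : (ℤ → (ℕ → Bool) × X) ≃ₜ (ℤ → (ℕ → Bool) × X) :=
    { toFun := fun z i => z (i + 1)
      invFun := fun z i => z (i - 1)
      left_inv := fun z => by simp
      right_inv := fun z => by simp
      continuous_toFun := continuous_pi fun i => continuous_apply (i + 1)
      continuous_invFun := continuous_pi fun i => continuous_apply (i - 1) }
  have hσE : ∀ x ∈ D, σ (orbitCode b φ x) = orbitCode b φ (f x) := by
    refine fun x hx => funext fun i => ?_
    change orbitCode b φ x (i + 1) = _
    simp only [orbitCode, φ, zIterate_succ (hgf x hx)]
  -- Invariance under `g` as well as `f` gives equality, so the shift restricts to a homeomorphism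
  -- of the closure.
  have himage : σ '' (orbitCode b φ '' D) = orbitCode b φ '' D := by
    ext z
    constructor
    · rintro ⟨_, ⟨x, hx, rfl⟩, rfl⟩
      exact ⟨f x, hfD hx, (hσE x hx).symm⟩
    · rintro ⟨x, hx, rfl⟩
      exact ⟨_, ⟨g x, hgD hx, rfl⟩, by rw [hσE _ (hgD hx), hfg x hx]⟩
  have hclosure : σ '' closure (orbitCode b φ '' D) = closure (orbitCode b φ '' D) := by
    rw [σ.image_closure, himage]
  let τ : closure (orbitCode b φ '' D) ≃ₜ closure (orbitCode b φ '' D) :=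
    (σ.image _).trans (Homeomorph.setCongr hclosure)
  obtain ⟨e⟩ := nonempty_homeomorph_closure_image_orbitCode hX hbo hb (i₀ := 0) hEπ hD hE
  refine ⟨(e.trans τ).trans e.symm, (fun z => π z.1) ∘ e,
    IsIrreducibleMap.comp_homeomorph ?_ e, MapsRel.conj_homeomorph (g := τ) ?_ e⟩
  · exact isIrreducibleMap_closure_image_section hD hE hπ fun x _ => hEπ x
  · exact mapsRel_graph_closure_image hF.isClosed hπ hEπ hf σ.continuous hσE fun z => rfl

end Main

theorem theorem4p10 {X : Type*} [MetricSpace X] [CompactSpace X] [Nonempty X]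
    (hX : ∀ x : X, ¬ IsOpen ({x} : Set X)) (F : SetRel X X) (hF : IsSuitable F) :
    (∃ (g : cantorSet → cantorSet) (h : cantorSet → X),
      Continuous g ∧ IsAlmostOpen g ∧ IsIrreducibleMap h ∧
        MapsRel h (Function.graph g) F) ∧
    (IsSuitableIso F →
      ∃ (g : cantorSet ≃ₜ cantorSet) (h : cantorSet → X),
        IsIrreducibleMap h ∧ MapsRel h (Function.graph g) F) :=
  ⟨hF.exists_cantorSet_lift hX, fun h => h.exists_cantorSet_lift hX⟩
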